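/- Let $d\ge 0$ be an integer, let $\mathcal{X}\subseteq\mathbb{R}^d$ be a set of arms (finite or infinite) and let $\theta^*\in\mathbb{R}^d$ be such that every arm has non-negative mean reward, i.e. $\langle x,\theta^*\rangle\ge 0$ for all $x\in\mathcal{X}$. Let $x^*\in\mathcal{X}$ be an optimal arm, i.e. $\langle x,\theta^*\rangle\le\langle x^*,\theta^*\rangle$ for all $x\in\mathcal{X}$. A John ellipsoid of a set $K\subseteq\mathbb{R}^d$ is a set $E=\{x\in\mathbb{R}^d:\sqrt{(x-c)^{T}H(x-c)}\le 1\}$, with center $c\in\mathbb{R}^d$ and $H\in\mathbb{R}^{d\times d}$ symmetric positive definite, that is contained in $K$ and has maximal volume among all such ellipsoids (with arbitrary center and positive definite matrix) contained in $K$. Let $c$ be the center of a John ellipsoid of the convex hull $\mathrm{cvh}(\mathcal{X})$, and let $U$ be a probability distribution on $\mathcal{X}$ with mean $\mathbb{E}_{x\sim U}[x]=c$. Then $$\mathbb{E}_{x\sim U}\big[\langle x,\theta^*\rangle\big]\;\ge\;\frac{\langle x^*,\theta^*\rangle}{d+1}.$$ -/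

import Mathlib

open scoped Matrix

namespace LinNash

/-- The norm `‖a‖_V = √(aᵀ V a)` of a vector `a ∈ ℝᵈ` with respect to a matrix `V`. -/
noncomputable def matrixNorm {d : ℕ} (V : Matrix (Fin d) (Fin d) ℝ)
    (a : EuclideanSpace ℝ (Fin d)) : ℝ :=
  √(a.ofLp ⬝ᵥ (V *ᵥ a.ofLp))

/-- The set `{x ∈ ℝᵈ : ‖x - c‖_H ≤ 1}`; for positive definite `H` this is the (closed, full
dimensional) ellipsoid with center `c` and shape matrix `H`. -/
def ellipsoid {d : ℕ} (c : EuclideanSpace ℝ (Fin d)) (H : Matrix (Fin d) (Fin d) ℝ) :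
    Set (EuclideanSpace ℝ (Fin d)) :=
  {x | matrixNorm H (x - c) ≤ 1}

/-- The ellipsoid with center `c` and positive definite shape matrix `H` is a John ellipsoid of
`K`: it is contained in `K`, and it has maximal (Lebesgue) volume among all ellipsoids contained
in `K`. -/
structure IsJohnEllipsoid {d : ℕ} (K : Set (EuclideanSpace ℝ (Fin d)))
    (c : EuclideanSpace ℝ (Fin d)) (H : Matrix (Fin d) (Fin d) ℝ) : Prop where
  posDef : H.PosDef
  subset : ellipsoid c H ⊆ K
  volume_le : ∀ (c' : EuclideanSpace ℝ (Fin d)) (H' : Matrix (Fin d) (Fin d) ℝ), H'.PosDef →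
    ellipsoid c' H' ⊆ K →
      MeasureTheory.volume (ellipsoid c' H') ≤ MeasureTheory.volume (ellipsoid c H)

/-- `c` is the center of a John ellipsoid of `K`. -/
def IsJohnCenter {d : ℕ} (K : Set (EuclideanSpace ℝ (Fin d)))
    (c : EuclideanSpace ℝ (Fin d)) : Prop :=
  ∃ H : Matrix (Fin d) (Fin d) ℝ, IsJohnEllipsoid K c H

end LinNash

namespace LinNash

open MeasureTheory Matrix

/-! By linearity the expected reward is `⟨c, θ⟩`. John's containment places `xstar` in the `d`-fold
dilation of the ellipsoid about `c`, so `c - (xstar - c) / d` lies in the ellipsoid, hence in the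
convex hull, where rewards are nonnegative; rearranging gives the bound. Containment
(`IsJohnEllipsoid.matrixNorm_sub_le`): after a linear change the ellipsoid is the unit ball. A point
at distance `R > d` would let the hull of ball and point contain an ellipsoid of larger volume. -/

/-- If `s > m`, a small stretch by `1 + k s` in one direction outweighs the shrinking by
`√(1 - 2 k)` in `m` directions. -/
theorem exists_stretch_volume_gt_one (m : ℕ) {s : ℝ} (hs : (m : ℝ) < s) :
    ∃ k : ℝ, 0 < k ∧ k < 1 / 2 ∧ 1 < (1 + k * s) ^ 2 * (1 - 2 * k) ^ m := by
  have hm : (0 : ℝ) ≤ m := m.cast_nonneg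
  have hs0 : 0 < s := hm.trans_lt hs
  -- To first order the product is `1 + 2k(s - m)`; this `k` keeps the loss `4k²sm` below half of
  -- that gain.
  obtain ⟨k, hk⟩ : ∃ k, k = (s - m) / (4 * s * (m + 1)) := ⟨_, rfl⟩
  have hk0 : 0 < k := by
    rw [hk]; exact div_pos (sub_pos.2 hs) (by positivity)
  have hks : 4 * (k * s * (m + 1)) = s - m := by
    rw [hk]; field_simp
  have hk4 : 4 * (k * (m + 1)) ≤ 1 := by
    refine le_of_mul_le_mul_right ?_ hs0
    linarith
  have hkm : 0 ≤ k * m := by positivity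
  have hbern : 1 - 2 * (k * m) ≤ (1 - 2 * k) ^ m := by
    have h := one_add_mul_le_pow (a := -(2 * k)) (by linarith) m
    calc 1 - 2 * (k * m) = 1 + m * -(2 * k) := by ring
      _ ≤ (1 + -(2 * k)) ^ m := h
      _ = (1 - 2 * k) ^ m := by ring
  refine ⟨k, hk0, by linarith, ?_⟩
  have hpos : 0 < 1 - 2 * (k * m) := by linarith
  have hgap : 0 < k * ((s - m) - 2 * (k * s * m)) := by
    refine mul_pos hk0 ?_
    have : 0 ≤ k * s * m := by positivity
    have : 0 < k * s := by positivity
    linarith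
  calc 1 < (1 + 2 * (k * s)) * (1 - 2 * (k * m)) := by linarith
    _ ≤ (1 + k * s) ^ 2 * (1 - 2 * (k * m)) := by
      refine mul_le_mul_of_nonneg_right ?_ hpos.le
      linarith [sq_nonneg (k * s)]
    _ ≤ (1 + k * s) ^ 2 * (1 - 2 * k) ^ m := by gcongr

/-- The ellipsoid with center `k (R - 1) e` and semi-axes `1 + k (R - 1)` along the unit vector `e`
and `√(1 - 2 k)` orthogonally to it lies in the convex hull of the unit ball and `R e`. -/
theorem stretched_ball_subset_cone {E : Type*} [NormedAddCommGroup E] [InnerProductSpace ℝ E]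
    {e z : E} (he : ‖e‖ = 1) {k R a b : ℝ} (hk0 : 0 < k) (hk : k < 1 / 2) (ha0 : 0 < a)
    (ha : a = 1 + k * (R - 1)) (hb0 : 0 < b) (hb : b ^ 2 = 1 - 2 * k)
    (hz : ‖(z - (k * (R - 1)) • e) + ((b / a - 1) * inner ℝ e (z - (k * (R - 1)) • e)) • e‖ ≤ b) :
    ∃ l : ℝ, 0 ≤ l ∧ l ≤ 1 ∧ ∃ w : E, ‖w‖ ≤ 1 ∧ z = l • R • e + (1 - l) • w := by
  obtain ⟨y, hy⟩ : ∃ y, y = z - (k * (R - 1)) • e := ⟨_, rfl⟩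
  rw [← hy] at hz
  have hexp : ∀ r : ℝ, ‖y + r • e‖ ^ 2 = ‖y‖ ^ 2 + 2 * r * inner ℝ e y + r ^ 2 := by
    intro r
    rw [norm_add_sq_real, norm_smul, he, inner_smul_right, real_inner_comm, mul_one,
      Real.norm_eq_abs, sq_abs]
    ring
  obtain ⟨x, hx⟩ : ∃ x, x = inner ℝ e y / a := ⟨_, rfl⟩
  have hxy : inner ℝ e y = a * x := by rw [hx]; field_simp
  have hcs : (a * x) ^ 2 ≤ ‖y‖ ^ 2 := by
    have h := abs_real_inner_le_norm e y
    rw [he, one_mul, hxy] at h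
    exact sq_le_sq.2 (by rwa [abs_norm])
  have hz2 : ‖y‖ ^ 2 - (a * x) ^ 2 + b ^ 2 * x ^ 2 ≤ b ^ 2 := by
    have h := pow_le_pow_left₀ (norm_nonneg _) hz 2
    rw [hexp, hxy] at h
    refine le_trans (le_of_eq ?_) h
    field_simp
    ring
  have hx1 : x ^ 2 ≤ 1 := by
    have hb2 : 0 < b ^ 2 := by positivity
    refine le_of_mul_le_mul_left ?_ hb2
    linarith
  obtain ⟨hxl, hxu⟩ := abs_le.1 ((sq_le_one_iff_abs_le_one x).1 hx1)
  have hl1 : k * (1 + x) < 1 := by nlinarith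
  have hpos : 0 < 1 - k * (1 + x) := sub_pos.2 hl1
  -- Here `x ∈ [-1, 1]` is the axial coordinate in units of `a`. With `l = k(1 + x)`, the part left
  -- for the ball has axial coordinate `x - l`, and `(1 - 2k)(1 - x²) + (x - l)² = (1 - l)²`.
  refine ⟨k * (1 + x), mul_nonneg hk0.le (by linarith), hl1.le,
    (1 - k * (1 + x))⁻¹ • (z - (k * (1 + x)) • R • e), ?_, ?_⟩
  · rw [norm_smul, norm_inv, Real.norm_of_nonneg hpos.le, inv_mul_le_iff₀ hpos, mul_one]
    refine le_of_sq_le_sq ?_ hpos.le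
    have hzy : z - (k * (1 + x)) • R • e = y + (k * (R - 1) - k * (1 + x) * R) • e := by
      rw [hy, sub_smul, smul_smul]; abel
    rw [hzy, hexp, hxy]
    rw [hb] at hz2
    calc _ ≤ (1 - 2 * k) - (1 - 2 * k) * x ^ 2
          + (a * x + (k * (R - 1) - k * (1 + x) * R)) ^ 2 := by linarith
      _ = (1 - k * (1 + x)) ^ 2 := by rw [ha]; ring
  · rw [smul_inv_smul₀ hpos.ne']; abel

variable {d : ℕ}

theorem matrixNorm_transpose_mul_self (B : Matrix (Fin d) (Fin d) ℝ)
    (x : EuclideanSpace ℝ (Fin d)) :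
    matrixNorm (Bᵀ * B) x = ‖Matrix.toEuclideanLin B x‖ := by
  rw [matrixNorm, EuclideanSpace.norm_eq, ← Matrix.mulVec_mulVec, Matrix.dotProduct_mulVec,
    Matrix.vecMul_transpose]
  simp [dotProduct, Matrix.toLpLin_apply, sq]

theorem ellipsoid_transpose_mul_self (c : EuclideanSpace ℝ (Fin d))
    (B : Matrix (Fin d) (Fin d) ℝ) :
    ellipsoid c (Bᵀ * B) = {x | ‖Matrix.toEuclideanLin B (x - c)‖ ≤ 1} := by
  simp only [ellipsoid, matrixNorm_transpose_mul_self]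

theorem volume_ellipsoid_transpose_mul_self (c : EuclideanSpace ℝ (Fin d))
    {B : Matrix (Fin d) (Fin d) ℝ} (hB : B.det ≠ 0) :
    volume (ellipsoid c (Bᵀ * B)) = ENNReal.ofReal |B.det⁻¹|
      * volume (Metric.closedBall (0 : EuclideanSpace ℝ (Fin d)) 1) := by
  have hdet : LinearMap.det (Matrix.toEuclideanLin B) = B.det := LinearMap.det_toLpLin 2 B
  rw [← hdet, ← Measure.addHaar_preimage_linearMap volume (by rwa [hdet]),
    ← measure_preimage_add_right volume c, ellipsoid_transpose_mul_self]
  congr 1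
  ext x
  simp

theorem exists_eq_transpose_mul_self {H : Matrix (Fin d) (Fin d) ℝ} (hH : H.PosDef) :
    ∃ B : Matrix (Fin d) (Fin d) ℝ, B.det ≠ 0 ∧ H = Bᵀ * B := by
  open scoped MatrixOrder in
  obtain ⟨B, hB⟩ := CStarAlgebra.nonneg_iff_eq_star_mul_self.mp hH.posSemidef.nonneg
  rw [Matrix.star_eq_conjTranspose, Matrix.conjTranspose_eq_transpose_of_trivial] at hB
  refine ⟨B, fun h => hH.det_pos.ne' ?_, hB⟩
  rw [hB, Matrix.det_mul, h, mul_zero]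

theorem posDef_transpose_mul_self {B : Matrix (Fin d) (Fin d) ℝ} (hB : B.det ≠ 0) :
    (Bᵀ * B).PosDef := by
  rw [← Matrix.conjTranspose_eq_transpose_of_trivial]
  exact Matrix.PosDef.conjTranspose_mul_self B (Matrix.mulVec_injective_iff_isUnit.2
    ((Matrix.isUnit_iff_isUnit_det B).2 hB.isUnit))

/-- Points of a convex set lie in the `d`-fold dilation of its John ellipsoid. -/
theorem IsJohnEllipsoid.matrixNorm_sub_le {K : Set (EuclideanSpace ℝ (Fin d))}
    (hK : Convex ℝ K) {c : EuclideanSpace ℝ (Fin d)} {H : Matrix (Fin d) (Fin d) ℝ}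
    (hJ : IsJohnEllipsoid K c H) {p : EuclideanSpace ℝ (Fin d)} (hp : p ∈ K) :
    matrixNorm H (p - c) ≤ d := by
  obtain ⟨B, hB, rfl⟩ := exists_eq_transpose_mul_self hJ.posDef
  rw [matrixNorm_transpose_mul_self]
  by_contra! hlt
  have hinj : Function.Injective (Matrix.toEuclideanLin B) :=
    (LinearMap.equivOfDetNeZero (Matrix.toEuclideanLin B)
      (by rwa [LinearMap.det_toLpLin])).injective
  have hsurj : Function.Surjective (Matrix.toEuclideanLin B) :=
    LinearMap.injective_iff_surjective.1 hinj
  obtain ⟨R, hR⟩ : ∃ R, R = ‖Matrix.toEuclideanLin B (p - c)‖ := ⟨_, rfl⟩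
  rw [← hR] at hlt
  have hR0 : 0 < R := (Nat.cast_nonneg d).trans_lt hlt
  obtain rfl | ⟨m, rfl⟩ : d = 0 ∨ ∃ m, d = m + 1 := by cases d <;> simp
  · rw [Subsingleton.elim (p - c) 0, map_zero, norm_zero] at hR
    exact hR0.ne' hR
  obtain ⟨e, hRe⟩ : ∃ e, R • e = Matrix.toEuclideanLin B (p - c) :=
    ⟨R⁻¹ • Matrix.toEuclideanLin B (p - c), smul_inv_smul₀ hR0.ne' _⟩
  have he : ‖e‖ = 1 := by
    have h := congrArg norm hRe
    rw [norm_smul, Real.norm_of_nonneg hR0.le, ← hR] at h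
    exact (mul_eq_left₀ hR0.ne').1 h
  have hmR : (m : ℝ) < R - 1 := by
    push_cast at hlt
    linarith
  obtain ⟨k, hk0, hk, hvol⟩ := exists_stretch_volume_gt_one m hmR
  obtain ⟨a, ha⟩ : ∃ a, a = 1 + k * (R - 1) := ⟨_, rfl⟩
  obtain ⟨b, hb⟩ : ∃ b, b = √(1 - 2 * k) := ⟨_, rfl⟩
  have ha0 : 0 < a := by
    rw [ha]
    have : 0 ≤ k * (R - 1) := mul_nonneg hk0.le ((Nat.cast_nonneg m).trans hmR.le)
    linarith
  have hb0 : 0 < b := by rw [hb]; exact Real.sqrt_pos.2 (by linarith)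
  have hb2 : b ^ 2 = 1 - 2 * k := by rw [hb]; exact Real.sq_sqrt (by linarith)
  have hab : 1 < a * b ^ m := by
    rw [← ha, ← hb2] at hvol
    refine (one_lt_sq_iff₀ (by positivity)).1 ?_
    calc 1 < a ^ 2 * (b ^ 2) ^ m := hvol
      _ = (a * b ^ m) ^ 2 := by ring
  -- `g` divides by `a` along `e` and by `b` on the `m` orthogonal directions, turning the stretched
  -- ellipsoid, once centred, into the unit ball.
  obtain ⟨g, hg⟩ : ∃ g : EuclideanSpace ℝ (Fin (m + 1)) →ₗ[ℝ] EuclideanSpace ℝ (Fin (m + 1)),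
      g = b⁻¹ • LinearMap.transvection ((b / a - 1) • (innerₗ _ e)) e := ⟨_, rfl⟩
  have hgdet : LinearMap.det g = (a * b ^ m)⁻¹ := by
    rw [hg, LinearMap.det_smul, LinearMap.transvection.det]
    simp [he]
    field_simp
    ring
  obtain ⟨M, hM⟩ : ∃ M, Matrix.toEuclideanLin M = g := ⟨_, LinearEquiv.apply_symm_apply _ g⟩
  have hMdet : M.det = (a * b ^ m)⁻¹ := by
    rw [← hgdet, ← hM, LinearMap.det_toLpLin]
  have hMB : (M * B).det ≠ 0 := by
    rw [Matrix.det_mul, hMdet]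
    exact mul_ne_zero (inv_ne_zero (by positivity)) hB
  obtain ⟨v, hv⟩ := hsurj ((k * (R - 1)) • e)
  have hsub : ellipsoid (c + v) ((M * B)ᵀ * (M * B)) ⊆ K := by
    intro x hx
    rw [ellipsoid_transpose_mul_self, Set.mem_ofPred_eq, Matrix.toLpLin_mul_same,
      LinearMap.comp_apply, hM, ← sub_sub, map_sub, hv, hg, LinearMap.smul_apply,
      LinearMap.transvection.apply, norm_smul, norm_inv, Real.norm_of_nonneg hb0.le,
      inv_mul_le_iff₀ hb0, mul_one, LinearMap.smul_apply, smul_eq_mul, innerₗ_apply_apply] at hx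
    obtain ⟨l, hl0, hl1, w, hw, hlw⟩ := stretched_ball_subset_cone he hk0 hk ha0 ha hb0 hb2 hx
    obtain ⟨u, rfl⟩ := hsurj w
    have hcu : c + u ∈ K := hJ.subset (by
      rwa [ellipsoid_transpose_mul_self, Set.mem_ofPred_eq, add_sub_cancel_left])
    rw [hRe, ← map_smul, ← map_smul, ← map_add] at hlw
    have hx' : x = l • p + (1 - l) • (c + u) := by
      rw [← sub_add_cancel x c, hinj hlw]
      module
    rw [hx']
    exact hK hp hcu hl0 (sub_nonneg.2 hl1) (by ring)
  have hle := hJ.volume_le _ _ (posDef_transpose_mul_self hMB) hsub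
  rw [volume_ellipsoid_transpose_mul_self _ hMB, volume_ellipsoid_transpose_mul_self _ hB,
    ENNReal.mul_le_mul_iff_left (Metric.measure_closedBall_pos volume _ one_pos).ne'
      measure_closedBall_lt_top.ne, ENNReal.ofReal_le_ofReal_iff (abs_nonneg _), Matrix.det_mul,
    hMdet, mul_inv, inv_inv, abs_mul, abs_of_pos (by positivity)] at hle
  have hBpos : 0 < |B.det⁻¹| := abs_pos.2 (inv_ne_zero hB)
  exact hle.not_gt (lt_mul_of_one_lt_left hBpos hab)

end LinNash

theorem mainTheorem4 (d : ℕ) (X : Set (EuclideanSpace ℝ (Fin d)))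
    (θ : EuclideanSpace ℝ (Fin d))
    (hmean : ∀ x ∈ X, 0 ≤ inner ℝ x θ)
    (xstar : EuclideanSpace ℝ (Fin d)) (hxstar : xstar ∈ X)
    (hopt : ∀ x ∈ X, inner ℝ x θ ≤ inner ℝ xstar θ)
    (c : EuclideanSpace ℝ (Fin d))
    (hc : LinNash.IsJohnCenter (convexHull ℝ X) c)
    (U : MeasureTheory.Measure (EuclideanSpace ℝ (Fin d)))
    [MeasureTheory.IsProbabilityMeasure U]
    (hUX : ∀ᵐ x ∂U, x ∈ X)
    (hUint : MeasureTheory.Integrable (fun x => x) U)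
    (hUc : ∫ x, x ∂U = c) :
    inner ℝ xstar θ / ((d : ℝ) + 1) ≤ ∫ x, inner ℝ x θ ∂U := by
  have hint : ∫ x, inner ℝ x θ ∂U = inner ℝ c θ := by
    simp_rw [real_inner_comm θ]
    rw [integral_inner hUint, hUc]
  rw [hint]
  -- The reflection divides by `d`; in dimension zero both sides vanish.
  obtain rfl | hd := Nat.eq_zero_or_pos d
  · simp [Subsingleton.elim xstar 0, Subsingleton.elim c 0]
  have hd0 : (0 : ℝ) < d := Nat.cast_pos.2 hd
  obtain ⟨H, hJ⟩ := hc
  have hnorm := hJ.matrixNorm_sub_le (convex_convexHull ℝ X) (subset_convexHull ℝ X hxstar)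
  have hnonneg : convexHull ℝ X ⊆ {x | 0 ≤ inner ℝ x θ} := by
    refine convexHull_min hmean fun x hx y hy a b ha hb _ => ?_
    simp only [Set.mem_ofPred_eq] at hx hy ⊢
    rw [inner_add_left, real_inner_smul_left, real_inner_smul_left]
    positivity
  have hmem : c - (d : ℝ)⁻¹ • (xstar - c) ∈ LinNash.ellipsoid c H := by
    obtain ⟨B, -, rfl⟩ := LinNash.exists_eq_transpose_mul_self hJ.posDef
    rw [LinNash.matrixNorm_transpose_mul_self] at hnorm
    rw [LinNash.ellipsoid_transpose_mul_self, Set.mem_ofPred_eq, sub_sub_cancel_left, map_neg,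
      norm_neg, map_smul, norm_smul, norm_inv, Real.norm_natCast, inv_mul_le_iff₀ hd0, mul_one]
    exact hnorm
  have h := hnonneg (hJ.subset hmem)
  simp only [Set.mem_ofPred_eq, inner_sub_left, real_inner_smul_left] at h
  rw [div_le_iff₀ (by positivity)]
  have h2 := mul_nonneg hd0.le h
  rw [mul_sub, mul_inv_cancel_left₀ hd0.ne'] at h2
  linarith
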